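/- A large ideal domain (LID) is a countable infinite (commutative) integral domain $R$ such that for every $x\in R\setminus\{0\}$ the ideal $xR$ has finite index in the additive group of $R$. Put $R^*=R\setminus\{0\}$. For $v\in R$ let $A_v:x\mapsto x+v$, and for $u\in R^*$ let $M_u:x\mapsto ux$. The affine semigroup $\mathcal A_R$ consists of all maps $x\mapsto ux+v$ of $R$ to itself with $u\in R^*$, $v\in R$, under composition. For a discrete set $X$, let $\beta X$ be the space of ultrafilters on $X$, topologized by the basic sets $\{p\in\beta X: E\in p\}$, $E\subset X$. For $p,q\in\beta R$ let $p+q=\{E\subset R:\{u:\{x: u+x\in E\}\in q\}\in p\}$, and for $p,q\in\beta(R^*)$ let $pq=\{E\subset R^*:\{u:\{x: ux\in E\}\in q\}\in p\}$. Let $\mathcal{AMI}$ be the set of non-principal $p\in\beta R$ with $p+p=p$ that belong to some minimal nonempty compact subset of $\beta R$ invariant under all the maps induced by $A_v$, $v\in R$. Let $\mathcal{MMI}$ be the set of non-principal $p\in\beta(R^*)$ with $pp=p$ that belong to some minimal nonempty compact subset of $\beta(R^*)$ invariant under all the maps induced by $M_u$, $u\in R^*$. Identify $\beta(R^*)$ with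 $\{p\in\beta R: R^*\in p\}$ and put $\mathcal G=\overline{\mathcal{AMI}}\cap\mathcal{MMI}$, with the closure taken in $\beta R$. Let $H$ be a (real or complex) Hilbert space and let $(U_g)_{g\in\mathcal A_R}$ be an isometric anti-representation of $\mathcal A_R$ on $H$, that is, a family of linear isometries $U_g:H\to H$ with $U_g(U_h\phi)=U_{hg}\phi$ for all $g,h\in\mathcal A_R$ and $\phi\in H$. Let $V_A$ be the orthogonal projection of $H$ onto the closed subspace of those $\phi$ for which $\{U_{A_v}\phi:v\in R\}$ is precompact in norm, and $V_M$ the orthogonal projection onto the closed subspace of those $\phi$ for which $\{U_{M_u}\phi:u\in R^*\}$ is precompact in norm. **Theorem.** Let $R$ be an LID and let $(U_g)_{g\in\mathcal A_R}$ be an isometric anti-representation of $\mathcal A_R$ on a Hilbert space $H$. Then for all $\phi,\psi\in H$ and all $p\in\mathcal G$, $$p\text{-}\lim_{u}\ \langle U_{A_u}\phi,\,U_{M_u}\psi\rangle=\langle V_A\phi,\,V_M\psi\rangle ,$$ that is, for every neighbourhood $W$ of the right-hand side, the set of $u\in R^*$ with $\langle U_{A_u}\phi,U_{M_u}\psi\rangle\in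 W$ belongs to $p$. -/

import Mathlib

open Filter Topology
open scoped nonZeroDivisors

/-- A large ideal domain: a countable infinite integral domain in which every nonzero principal
ideal has finite index as an additive subgroup. -/
structure IsLargeIdealDomain (R : Type*) [CommRing R] [IsDomain R] : Prop where
  countable : Countable R
  infinite : Infinite R
  finiteIndex : ∀ x : R, x ≠ 0 → (Submodule.toAddSubgroup (Ideal.span {x})).FiniteIndex

/-- The affine semigroup of `R`: all maps `x ↦ u * x + v` with `u ≠ 0`, under composition
(the multiplication of `Function.End R` is composition of functions). -/
def affineSemigroup (R : Type*) [CommRing R] [IsDomain R] : Submonoid (Function.End R) where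
  carrier := {f | ∃ u v : R, u ≠ 0 ∧ ∀ x, f x = u * x + v}
  one_mem' := ⟨1, 0, one_ne_zero, fun x => by
    change x = _
    simp⟩
  mul_mem' := by
    rintro f g ⟨u, v, hu, hf⟩ ⟨u', v', hu', hg⟩
    refine ⟨u * u', u * v' + v, mul_ne_zero hu hu', fun x => ?_⟩
    change f (g x) = _
    rw [hg, hf]
    ring

/-- The translation `A_v : x ↦ x + v`. -/
def affineAdd {R : Type*} [CommRing R] [IsDomain R] (v : R) : affineSemigroup R :=
  ⟨fun x => x + v, 1, v, one_ne_zero, fun x => by simp⟩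

/-- The multiplication `M_u : x ↦ u * x`, for `u` in the multiplicative monoid `R⁰`
of nonzero elements of the domain `R`. -/
def affineMul {R : Type*} [CommRing R] [IsDomain R] (u : R⁰) : affineSemigroup R :=
  ⟨fun x => (u : R) * x, u, 0, nonZeroDivisors.coe_ne_zero u, fun x => by simp⟩

/-- `Y` is a minimal nonempty compact subset of `X` invariant under all the maps `f i`. -/
def IsMinimalInvariant {ι X : Type*} [TopologicalSpace X] (f : ι → X → X) (Y : Set X) : Prop :=
  Minimal (fun Z : Set X => Z.Nonempty ∧ IsCompact Z ∧ ∀ i, Set.MapsTo (f i) Z Z) Y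

section Ultrafilters

attribute [local instance] Ultrafilter.add Ultrafilter.mul

/-- The additive minimal idempotents in `βR`. -/
def AMI (R : Type*) [CommRing R] : Set (Ultrafilter R) :=
  {p | (∀ x : R, p ≠ pure x) ∧
    (∃ Y : Set (Ultrafilter R),
      IsMinimalInvariant (fun v : R => Ultrafilter.map (fun x => x + v)) Y ∧ p ∈ Y) ∧
    p + p = p}

/-- The multiplicative minimal idempotents in `β(R⁰)`. -/
def MMI (R : Type*) [CommRing R] : Set (Ultrafilter R⁰) :=
  {p | (∀ x : R⁰, p ≠ pure x) ∧
    (∃ Y : Set (Ultrafilter R⁰),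
      IsMinimalInvariant (fun u : R⁰ => Ultrafilter.map (fun x => u * x)) Y ∧ p ∈ Y) ∧
    p * p = p}

end Ultrafilters

/-- The intersection of `MMI` with the closure in `βR` of `AMI`. An ultrafilter on the nonzero
elements is regarded as an ultrafilter on `R` through its image under the inclusion. -/
def doubleMinimal (R : Type*) [CommRing R] : Set (Ultrafilter R⁰) :=
  {p | p ∈ MMI R ∧ p.map (fun u : R⁰ => (u : R)) ∈ closure (AMI R)}

section Hilbert

variable {𝕜 H ι : Type*} [RCLike 𝕜] [NormedAddCommGroup H] [InnerProductSpace 𝕜 H]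
  [CompleteSpace H]

/-- The vectors whose orbit under the isometries `T i` is precompact in norm. -/
def compactVectors (T : ι → H →ₗᵢ[𝕜] H) : Submodule 𝕜 H where
  carrier := {φ | IsCompact (closure (Set.range fun i => T i φ))}
  zero_mem' := by
    have h : (Set.range fun i => T i (0 : H)) ⊆ {0} := by
      rintro _ ⟨i, rfl⟩
      simp
    exact isCompact_singleton.closure_of_subset h
  add_mem' := by
    intro a b ha hb
    have ha' : IsCompact (closure (Set.range fun i => T i a)) := ha
    have hb' : IsCompact (closure (Set.range fun i => T i b)) := hb
    refine (ha'.add hb').closure_of_subset ?_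
    rintro _ ⟨i, rfl⟩
    exact ⟨T i a, subset_closure ⟨i, rfl⟩, T i b, subset_closure ⟨i, rfl⟩, by simp⟩
  smul_mem' := by
    intro c a ha
    have ha' : IsCompact (closure (Set.range fun i => T i a)) := ha
    refine (ha'.image (continuous_const_smul c)).closure_of_subset ?_
    rintro _ ⟨i, rfl⟩
    exact ⟨T i a, subset_closure ⟨i, rfl⟩, by simp⟩

theorem isClosed_compactVectors (T : ι → H →ₗᵢ[𝕜] H) :
    IsClosed (compactVectors T : Set H) := by
  refine isClosed_of_closure_subset fun φ hφ => ?_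
  change IsCompact (closure (Set.range fun i => T i φ))
  refine TotallyBounded.isCompact_of_isClosed (TotallyBounded.closure ?_) isClosed_closure
  rw [Metric.totallyBounded_iff]
  intro ε hε
  obtain ⟨χ, hχ, hd⟩ := Metric.mem_closure_iff.1 hφ (ε / 2) (half_pos hε)
  have hχ' : IsCompact (closure (Set.range fun i => T i χ)) := hχ
  obtain ⟨t, ht, hc⟩ :=
    Metric.totallyBounded_iff.1 (hχ'.totallyBounded.subset subset_closure) (ε / 2) (half_pos hε)
  refine ⟨t, ht, ?_⟩
  rintro _ ⟨i, rfl⟩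
  obtain ⟨y, hy, hiy⟩ := Set.mem_iUnion₂.1 (hc ⟨i, rfl⟩)
  refine Set.mem_iUnion₂.2 ⟨y, hy, ?_⟩
  have h1 : dist (T i φ) (T i χ) < ε / 2 := by rwa [(T i).dist_map]
  have h2 : dist (T i χ) y < ε / 2 := hiy
  exact Metric.mem_ball.2 (by linarith [dist_triangle (T i φ) (T i χ) y])

instance (T : ι → H →ₗᵢ[𝕜] H) : CompleteSpace (compactVectors T) :=
  (isClosed_compactVectors T).completeSpace_coe

/-- The orthogonal projection of `H` onto the compact vectors of the family `T`. -/
noncomputable def compactProjection (T : ι → H →ₗᵢ[𝕜] H) : H →L[𝕜] H :=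
  (compactVectors T).starProjection

end Hilbert

/-- `U` is an isometric anti-representation: each `U g` is a linear isometry and
`U g (U h φ) = U (h * g) φ`. -/
def IsAntiRepresentation {R 𝕜 H : Type*} [CommRing R] [IsDomain R] [RCLike 𝕜]
    [NormedAddCommGroup H] [InnerProductSpace 𝕜 H]
    (U : affineSemigroup R → H →ₗᵢ[𝕜] H) : Prop :=
  ∀ (g h : affineSemigroup R) (φ : H), U g (U h φ) = U (h * g) φ

/-!
Write `a_v = U (affineAdd v)` and `m_u = U (affineMul u)`, so that `a_u m_w = m_w a_{wu}`.

Along an idempotent ultrafilter with syndetic return times, a representation of a monoid by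
isometries converges strongly to the identity on its compact vectors
(`tendsto_of_mem_compactVectors`) and weakly to `0` on their orthogonal complement
(`tendsto_inner_zero_of_mem_orthogonal`). Minimal idempotents are of this kind
(`IsMinimalInvariant.syndetic`). An ultrafilter in `doubleMinimal R` is itself one for the
multiplication, and is a limit of such ultrafilters for the addition, which is enough because
membership of a fixed set is a closed condition on ultrafilters.

Split `φ` into its part `φ_c` compact for the translations and a part `φ'` orthogonal to the compact
vectors. Since `a_u φ_c` tends to `φ_c` in norm and `m_u ψ` tends weakly to the projection of `ψ`
to the compact vectors of the dilations, `φ_c` contributes exactly the asserted limit. It remains to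
see that `⟪a_u φ', m_u ψ⟫` tends to `0` (`IsAntiRepresentation.tendsto_inner_zero`).

Let `L` be the limit. As `p` is a nonprincipal multiplicative idempotent, for infinitely many `b`
the limit of `⟪a_{bu} φ', m_{bu} ψ⟫` along `p` is close to `L`. Take finitely many such `b_i` with
distinct squares, and let `B` be their product. Applying the isometry `m_{B / b_i}` rewrites the
`i`-th correlation as `⟪y_i, m_{Bu} ψ⟫` with `y_i = m_{B / b_i} a_{b_i u} φ'`. Only isometries occur,
so no inverse of `m_u` is available. Instead one uses that `p` contains all ideals `dR`, by the
finite index hypothesis: for `u = b_i b_j t` the commutation relation gives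
`⟪y_i, y_j⟫ = ⟪a_{(b_i² - b_j²) t} m_{b_j} φ', m_{b_i} φ'⟫`. The vector `m_{b_j} φ'` is again
orthogonal to the compact vectors of the translations (`affineMul_mem_orthogonal`), even of those
by a nonzero ideal `cR` (`compactVectors_mul_le`), so this tends to `0`
(`eventually_norm_inner_lt`). Hence the `y_i` are almost orthogonal, and averaging over many of
them forces `L = 0`.
-/

/-! ### Idempotent ultrafilters with syndetic return times -/

/-- An idempotent ultrafilter `p` on a monoid such that for each `E ∈ p` the set of `s` with
`s⁻¹ E ∈ p` is syndetic. Only the inclusion `p ⊆ p * p` of the idempotence is recorded. These are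
the properties of minimal idempotents that matter here, and unlike minimality itself they pass
without effort to the quotient of an ultrafilter on a ring by a ring element. -/
structure IsSyndeticIdempotent {G : Type*} [Monoid G] (p : Ultrafilter G) : Prop where
  idem : ∀ E ∈ p, ∀ᶠ g in (p : Filter G), ∀ᶠ h in (p : Filter G), g * h ∈ E
  syndetic : ∀ E ∈ p, ∃ F : Finset G, ∀ g, ∃ f ∈ F, ∀ᶠ x in (p : Filter G), f * (g * x) ∈ E

/-- Members of a minimal invariant set return syndetically: otherwise, by compactness, the points
of `Y` whose orbit avoids the clopen set given by `E` form a proper invariant compact subset. -/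
theorem IsMinimalInvariant.syndetic {G : Type*} [Monoid G] {Y : Set (Ultrafilter G)}
    (hY : IsMinimalInvariant (fun g : G => Ultrafilter.map (fun x => g * x)) Y)
    {p : Ultrafilter G} (hp : p ∈ Y) {E : Set G} (hE : E ∈ p) :
    ∃ F : Finset G, ∀ g, ∃ f ∈ F, ∀ᶠ x in (p : Filter G), f * (g * x) ∈ E := by
  obtain ⟨⟨-, hYc, hYinv⟩, hmin⟩ := hY
  have hopen : ∀ f : G, IsOpen {q : Ultrafilter G | {x | f * x ∈ E} ∈ q} := fun f =>
    ultrafilter_isOpen_basic _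
  have hcover : Y ⊆ ⋃ f : G, {q : Ultrafilter G | {x | f * x ∈ E} ∈ q} := by
    intro q hq
    by_contra hq'
    have hZ := hmin (y := Y ∩ (⋃ f : G, {q : Ultrafilter G | {x | f * x ∈ E} ∈ q})ᶜ)
      ⟨⟨q, hq, hq'⟩, hYc.inter_right (isOpen_iUnion hopen).isClosed_compl, ?_⟩
      Set.inter_subset_left
    · refine (hZ hp).2 (Set.mem_iUnion.2 ⟨1, ?_⟩)
      simpa using hE
    · rintro g r ⟨hr, hr'⟩
      refine ⟨hYinv g hr, fun h => hr' ?_⟩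
      obtain ⟨f, hf⟩ := Set.mem_iUnion.1 h
      refine Set.mem_iUnion.2 ⟨f * g, ?_⟩
      have hf' : {x | f * (g * x) ∈ E} ∈ r := hf
      change {x | f * g * x ∈ E} ∈ r
      simpa only [mul_assoc] using hf'
  obtain ⟨F, hF⟩ := hYc.elim_finite_subcover _ hopen hcover
  refine ⟨F, fun g => ?_⟩
  obtain ⟨f, hf, hfE⟩ := Set.mem_iUnion₂.1 (hF (hYinv g hp))
  exact ⟨f, hf, hfE⟩

theorem isSyndeticIdempotent_of_mem_MMI {R : Type*} [CommRing R] {p : Ultrafilter R⁰}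
    (hp : p ∈ MMI R) : IsSyndeticIdempotent p := by
  obtain ⟨-, ⟨Y, hY, hpY⟩, hpp⟩ := hp
  refine ⟨fun E hE => ?_, fun E hE => hY.syndetic hpY hE⟩
  rw [← hpp] at hE
  exact hE

theorem isSyndeticIdempotent_of_mem_AMI {R : Type*} [CommRing R] {p : Ultrafilter R}
    (hp : p ∈ AMI R) : IsSyndeticIdempotent (p.map Multiplicative.ofAdd) := by
  obtain ⟨-, ⟨Y, hY, hpY⟩, hpp⟩ := hp
  refine ⟨fun E hE => ?_, fun E hE => ?_⟩
  · have hE' : Multiplicative.ofAdd ⁻¹' E ∈ p := hE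
    rw [← hpp] at hE'
    exact hE'
  · have hY' : IsMinimalInvariant
        (fun g : Multiplicative R => Ultrafilter.map (fun x => g * x)) Y := by
      simp only [add_comm] at hY
      exact hY
    exact hY'.syndetic hpY hE

/-- Dividing an ultrafilter that contains `dR` by `d` preserves the property. -/
theorem exists_isSyndeticIdempotent_map_mul {R : Type*} [CommRing R] [IsDomain R]
    {p : Ultrafilter R} (hp : IsSyndeticIdempotent (p.map Multiplicative.ofAdd)) {d : R}
    (hd : d ≠ 0) (hdp : Set.range (d * ·) ∈ p) :
    ∃ q : Ultrafilter R, q.map (d * ·) = p ∧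
      IsSyndeticIdempotent (q.map Multiplicative.ofAdd) := by
  have hinj : Function.Injective (d * · : R → R) := mul_right_injective₀ hd
  obtain ⟨q, rfl⟩ : ∃ q : Ultrafilter R, q.map (d * ·) = p :=
    ⟨p.comap hinj hdp, Ultrafilter.coe_injective (by simpa using Filter.map_comap_of_mem hdp)⟩
  have hmem : ∀ E ∈ q.map Multiplicative.ofAdd,
      (fun x : R => Multiplicative.ofAdd (d * x)) '' (Multiplicative.ofAdd ⁻¹' E) ∈
        (q.map (d * ·)).map Multiplicative.ofAdd := fun E hE => by
    have hE' : Multiplicative.ofAdd ⁻¹' E ∈ q := hE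
    have : (fun x : R => Multiplicative.ofAdd (d * x)) ⁻¹' ((fun x : R =>
        Multiplicative.ofAdd (d * x)) '' (Multiplicative.ofAdd ⁻¹' E)) ∈ q :=
      mem_of_superset hE' fun x hx => ⟨x, hx, rfl⟩
    exact this
  refine ⟨q, rfl, fun E hE => ?_, fun E hE => ?_⟩
  · have h : ∀ᶠ s in (q : Filter R), ∀ᶠ t in (q : Filter R), ∃ x,
        Multiplicative.ofAdd x ∈ E ∧ d * x = d * s + d * t := hp.idem _ (hmem E hE)
    change ∀ᶠ s in (q : Filter R), ∀ᶠ t in (q : Filter R), Multiplicative.ofAdd (s + t) ∈ E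
    filter_upwards [h] with s hs
    filter_upwards [hs] with t ht
    obtain ⟨x, hx, hxe⟩ := ht
    rw [← mul_add] at hxe
    rwa [← hinj hxe]
  · obtain ⟨F, hF⟩ := hp.syndetic _ (hmem E hE)
    classical
    refine ⟨F.preimage (fun x : Multiplicative R => Multiplicative.ofAdd (d * x.toAdd))
      (fun x _ y _ h => hinj h), fun g => ?_⟩
    obtain ⟨f, hf, hfE⟩ := hF (Multiplicative.ofAdd (d * g.toAdd))
    have hfE' : ∀ᶠ t in (q : Filter R), ∃ x, Multiplicative.ofAdd x ∈ E ∧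
        d * x = f.toAdd + (d * g.toAdd + d * t) := hfE
    -- a single return already shows that the translate `f` is divisible by `d`
    obtain ⟨t, x, hx, hxe⟩ := hfE'.exists
    have hfd : f.toAdd = d * (x - g.toAdd - t) := by linear_combination -hxe
    refine ⟨Multiplicative.ofAdd (x - g.toAdd - t), Finset.mem_preimage.2 ?_, ?_⟩
    · have : Multiplicative.ofAdd (d * (x - g.toAdd - t)) = f := by rw [← hfd]; rfl
      exact this ▸ hf
    · change ∀ᶠ s in (q : Filter R),
        Multiplicative.ofAdd ((x - g.toAdd - t) + (g.toAdd + s)) ∈ E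
      filter_upwards [hfE'] with s hs
      obtain ⟨y, hy, hye⟩ := hs
      have : y = (x - g.toAdd - t) + (g.toAdd + s) := hinj (by
        change d * y = d * _
        rw [hye, hfd]; ring)
      rwa [← this]

theorem mem_of_mem_closure_ultrafilter {X : Type*} {S : Set (Ultrafilter X)} {p : Ultrafilter X}
    (hp : p ∈ closure S) {E : Set X} (hE : ∀ q ∈ S, E ∈ q) : E ∈ p :=
  closure_minimal (t := {q : Ultrafilter X | E ∈ q}) hE (ultrafilter_isClosed_basic E) hp

/-- An additively idempotent ultrafilter contains every subgroup of finite index, since its image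
in the quotient is a principal idempotent. -/
theorem mem_of_finiteIndex {R : Type*} [CommRing R] {p : Ultrafilter R}
    (hp : IsSyndeticIdempotent (p.map Multiplicative.ofAdd)) (N : AddSubgroup R) [N.FiniteIndex] :
    (N : Set R) ∈ p := by
  have : Finite (R ⧸ N) := AddSubgroup.finite_quotient_of_finiteIndex
  obtain ⟨c, hc⟩ := Ultrafilter.eq_pure_of_finite (p.map (QuotientAddGroup.mk : R → R ⧸ N))
  have hcp : ∀ᶠ x in (p : Filter R), QuotientAddGroup.mk (s := N) x = c := by
    have : {c} ∈ p.map (QuotientAddGroup.mk : R → R ⧸ N) := by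
      rw [hc]; exact Set.mem_singleton c
    exact this
  have h : ∀ᶠ s in (p : Filter R), ∀ᶠ t in (p : Filter R),
      QuotientAddGroup.mk (s := N) (s + t) = c :=
    hp.idem {x | QuotientAddGroup.mk (s := N) x.toAdd = c} hcp
  obtain ⟨s, hs, hs'⟩ := (h.and hcp).exists
  obtain ⟨t, ht, ht'⟩ := (hs.and hcp).exists
  have hc0 : c = 0 := by simpa [hs', ht'] using ht
  filter_upwards [hcp] with x hx
  exact (QuotientAddGroup.eq_zero_iff x).1 (hx.trans hc0)

theorem IsLargeIdealDomain.range_mul_mem {R : Type*} [CommRing R] [IsDomain R]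
    (hR : IsLargeIdealDomain R) {p : Ultrafilter R}
    (hp : IsSyndeticIdempotent (p.map Multiplicative.ofAdd)) {d : R} (hd : d ≠ 0) :
    Set.range (d * ·) ∈ p := by
  have := hR.finiteIndex d hd
  refine mem_of_superset
    (mem_of_finiteIndex hp (Submodule.toAddSubgroup (Ideal.span {d}))) fun x hx => ?_
  obtain ⟨y, hy⟩ := Ideal.mem_span_singleton'.1 hx
  exact ⟨y, by simpa [mul_comm] using hy⟩

/-! ### Limits of isometries along such ultrafilters -/

section Isometries

variable {𝕜 H ι : Type*} [RCLike 𝕜] [NormedAddCommGroup H] [InnerProductSpace 𝕜 H]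

theorem exists_weak_limit [CompleteSpace H] (p : Ultrafilter ι) (T : ι → H →ₗᵢ[𝕜] H) (φ : H) :
    ∃ y : H, ∀ χ, Tendsto (fun i => inner 𝕜 (T i φ) χ) p (𝓝 (inner 𝕜 y χ)) := by
  have hb : ∀ χ i, ‖inner 𝕜 (T i φ) χ‖ ≤ ‖φ‖ * ‖χ‖ := fun χ i => by
    simpa using norm_inner_le_norm (𝕜 := 𝕜) (T i φ) χ
  have hl : ∀ χ, ∃ l ∈ Metric.closedBall (0 : 𝕜) (‖φ‖ * ‖χ‖),
      Tendsto (fun i => inner 𝕜 (T i φ) χ) p (𝓝 l) := fun χ => by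
    obtain ⟨l, hl, h⟩ := (isCompact_closedBall (0 : 𝕜) (‖φ‖ * ‖χ‖)).ultrafilter_le_nhds
      (p.map fun i => inner 𝕜 (T i φ) χ)
      (le_principal_iff.2 (Filter.mem_map.2 (Filter.Eventually.of_forall fun i => by
        simpa using hb χ i)))
    exact ⟨l, hl, h⟩
  choose l hlb hl using hl
  let L : H →ₗ[𝕜] 𝕜 :=
    { toFun := l
      map_add' := fun a b => tendsto_nhds_unique (hl (a + b)) (by
        simpa only [inner_add_right] using (hl a).add (hl b))
      map_smul' := fun c a => tendsto_nhds_unique (hl (c • a)) (by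
        simpa only [inner_smul_right, smul_eq_mul, RingHom.id_apply] using (hl a).const_mul c) }
  refine ⟨(InnerProductSpace.toDual 𝕜 H).symm (L.mkContinuous ‖φ‖ fun χ => by
    simpa [L] using hlb χ), fun χ => ?_⟩
  simpa [InnerProductSpace.toDual_symm_apply, L] using hl χ

/-- For an isometry, a vector almost fixed in the weak sense is almost fixed in norm. -/
theorem tendsto_of_tendsto_inner_self {p : Filter ι} {T : ι → H →ₗᵢ[𝕜] H} {y : H}
    (h : Tendsto (fun i => inner 𝕜 (T i y) y) p (𝓝 (inner 𝕜 y y))) :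
    Tendsto (fun i => T i y) p (𝓝 y) := by
  rw [tendsto_iff_norm_sub_tendsto_zero]
  have h1 : Tendsto (fun i => ‖y‖ ^ 2 - 2 * RCLike.re (inner 𝕜 (T i y) y) + ‖y‖ ^ 2) p (𝓝 0) := by
    have h2 := ((((RCLike.continuous_re.tendsto _).comp h).const_mul 2).const_sub
      (‖y‖ ^ 2)).add_const (‖y‖ ^ 2)
    have h3 : ‖y‖ ^ 2 - 2 * RCLike.re (inner 𝕜 y y) + ‖y‖ ^ 2 = 0 := by
      rw [inner_self_eq_norm_sq]
      ring
    rwa [h3] at h2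
  have h3 := (Real.continuous_sqrt.tendsto 0).comp h1
  rw [Real.sqrt_zero] at h3
  refine h3.congr fun i => ?_
  have h4 := @norm_sub_sq 𝕜 _ _ _ _ (T i y) y
  rw [(T i).norm_map] at h4
  simp only [Function.comp]
  rw [← h4, Real.sqrt_sq (norm_nonneg _)]

variable {G : Type*} [Monoid G] {p : Ultrafilter G} {T : G → H →ₗᵢ[𝕜] H}

/-- A vector recurrent along `p` has a totally bounded orbit: for a syndetic set of `s` the vector
`T s y` is close to `y`, so the orbit is covered by the preimages of one small ball under finitely
many of the isometries. -/
theorem mem_compactVectors_of_tendsto [CompleteSpace H] (hp : IsSyndeticIdempotent p)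
    (hT : ∀ g h φ, T (g * h) φ = T g (T h φ)) {y : H} (hy : Tendsto (fun g => T g y) p (𝓝 y)) :
    y ∈ compactVectors T := by
  change IsCompact (closure (Set.range fun i => T i y))
  refine TotallyBounded.isCompact_of_isClosed (TotallyBounded.closure ?_) isClosed_closure
  rw [Metric.totallyBounded_iff]
  intro ε hε
  have hE : ∀ᶠ g in (p : Filter G), dist (T g y) y < ε / 4 :=
    Metric.tendsto_nhds.1 hy _ (by positivity)
  obtain ⟨F, hF⟩ := hp.syndetic _ hE
  have hret : ∀ g, ∃ f ∈ F, dist (T f (T g y)) y < ε / 2 := fun g => by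
    obtain ⟨f, hf, h⟩ := hF g
    obtain ⟨x, hx, hxE⟩ := (h.and hE).exists
    refine ⟨f, hf, ?_⟩
    have h1 : dist (T f (T g (T x y))) y < ε / 4 := by
      have : dist (T (f * (g * x)) y) y < ε / 4 := hx
      rwa [hT, hT] at this
    have h2 : dist (T f (T g y)) (T f (T g (T x y))) < ε / 4 := by
      rw [(T f).dist_map, (T g).dist_map, dist_comm]
      exact hxE
    linarith [dist_triangle (T f (T g y)) (T f (T g (T x y))) y]
  have hc : ∀ f, ∃ c : H, ∀ g, dist (T f (T g y)) y < ε / 2 → dist (T g y) c < ε := fun f => by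
    by_cases h : ∃ g, dist (T f (T g y)) y < ε / 2
    · obtain ⟨g₀, h₀⟩ := h
      refine ⟨T g₀ y, fun g hg => ?_⟩
      rw [← (T f).dist_map]
      linarith [dist_triangle_right (T f (T g y)) (T f (T g₀ y)) y]
    · exact ⟨0, fun g hg => (h ⟨g, hg⟩).elim⟩
  choose c hc using hc
  refine ⟨c '' F, F.finite_toSet.image c, ?_⟩
  rintro _ ⟨g, rfl⟩
  obtain ⟨f, hf, h⟩ := hret g
  exact Set.mem_iUnion₂.2 ⟨c f, ⟨f, hf, rfl⟩, hc f g h⟩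

/-- Isometries converge strongly to the identity on compact vectors along an idempotent: the limit
`y` of `T g φ` is also the limit of `T g y`, and then `T g φ - T g y` tends to `0`. -/
theorem tendsto_of_mem_compactVectors (hp : IsSyndeticIdempotent p)
    (hT : ∀ g h φ, T (g * h) φ = T g (T h φ)) {φ : H} (hφ : φ ∈ compactVectors T) :
    Tendsto (fun g => T g φ) p (𝓝 φ) := by
  have hφ' : IsCompact (closure (Set.range fun i => T i φ)) := hφ
  obtain ⟨y, -, hy⟩ := hφ'.ultrafilter_le_nhds (p.map fun g => T g φ)
    (le_principal_iff.2 (Filter.mem_map.2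
      (Filter.Eventually.of_forall fun i => subset_closure ⟨i, rfl⟩)))
  have hy : Tendsto (fun g => T g φ) p (𝓝 y) := hy
  have hy' : Tendsto (fun g => T g y) p (𝓝 y) := by
    rw [Metric.tendsto_nhds] at hy ⊢
    intro ε hε
    filter_upwards [hp.idem _ (hy (ε / 2) (half_pos hε))] with g hg
    obtain ⟨h, h1, h2⟩ := (hg.and (hy (ε / 2) (half_pos hε))).exists
    have h1 : dist (T (g * h) φ) y < ε / 2 := h1
    rw [hT] at h1
    rw [← (T g).dist_map, dist_comm] at h2
    linarith [dist_triangle (T g y) (T g (T h φ)) y]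
  have h0 : Tendsto (fun g => dist (T g φ) (T g y)) p (𝓝 0) := by
    simpa using hy.dist hy'
  simp only [LinearIsometry.dist_map] at h0
  have : φ = y := dist_eq_zero.1 (tendsto_nhds_unique tendsto_const_nhds h0)
  rwa [← this] at hy'

/-- The isometries converge weakly to `0` on the complement of the compact vectors: the weak limit
`y` of `T g φ` is fixed in the limit, hence compact and orthogonal to `φ`, so that
`⟪y, y⟫ = lim ⟪T g φ, y⟫ = lim ⟪T g φ, T g y⟫ = 0`. -/
theorem tendsto_inner_zero_of_mem_orthogonal [CompleteSpace H]
    (hp : IsSyndeticIdempotent p) (hT : ∀ g h φ, T (g * h) φ = T g (T h φ)) {φ : H}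
    (hφ : φ ∈ (compactVectors T)ᗮ) (χ : H) :
    Tendsto (fun g => inner 𝕜 (T g φ) χ) p (𝓝 0) := by
  obtain ⟨y, hy⟩ := exists_weak_limit p T φ
  have hyy : Tendsto (fun g => T g y) p (𝓝 y) := by
    refine tendsto_of_tendsto_inner_self (𝕜 := 𝕜) ?_
    rw [Metric.tendsto_nhds]
    intro ε hε
    filter_upwards [hp.idem _ (Metric.tendsto_nhds.1 (hy y) (ε / 2) (half_pos hε))] with g hg
    have h1 : Tendsto (fun h => inner 𝕜 (T (g * h) φ) y) p (𝓝 (inner 𝕜 (T g y) y)) := by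
      have := hy ((T g).toContinuousLinearMap.adjoint y)
      simpa only [ContinuousLinearMap.adjoint_inner_right,
        LinearIsometry.coe_toContinuousLinearMap, ← hT] using this
    have h2 := le_of_tendsto (h1.dist tendsto_const_nhds)
      (hg.mono fun h (hh : dist _ _ < _) => hh.le)
    linarith
  have hφy : inner 𝕜 φ y = 0 :=
    (Submodule.mem_orthogonal' _ _).1 hφ y (mem_compactVectors_of_tendsto hp hT hyy)
  have h0 : Tendsto (fun g => inner 𝕜 (T g φ) y) p (𝓝 0) := by
    refine squeeze_zero_norm (a := fun g => ‖φ‖ * ‖y - T g y‖) (fun g => ?_) ?_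
    · have : inner 𝕜 (T g φ) y = inner 𝕜 (T g φ) (y - T g y) := by
        rw [inner_sub_right, (T g).inner_map_map, hφy, sub_zero]
      rw [this]
      simpa using norm_inner_le_norm (𝕜 := 𝕜) (T g φ) (y - T g y)
    · simpa using ((tendsto_const_nhds.sub hyy).norm.const_mul ‖φ‖ :
        Tendsto (fun g => ‖φ‖ * ‖y - T g y‖) p (𝓝 (‖φ‖ * ‖y - y‖)))
  have hy0 : y = 0 := inner_self_eq_zero.1 (tendsto_nhds_unique (hy y) h0)
  simpa [hy0] using hy χ

end Isometries

/-! ### Almost orthogonal vectors and squares -/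

/-- A sum of `N` almost orthogonal vectors of bounded norm has norm of order `√N`. -/
theorem norm_sum_sq_le_of_almost_orthogonal {𝕜 H ι : Type*} [RCLike 𝕜] [NormedAddCommGroup H]
    [InnerProductSpace 𝕜 H] (s : Finset ι) (y : ι → H) {M ε : ℝ} (hM : ∀ i ∈ s, ‖y i‖ = M)
    (hε : 0 ≤ ε) (h : ∀ i ∈ s, ∀ j ∈ s, i ≠ j → ‖inner 𝕜 (y i) (y j)‖ ≤ ε) :
    ‖∑ i ∈ s, y i‖ ^ 2 ≤ s.card * M ^ 2 + s.card ^ 2 * ε := by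
  classical
  calc ‖∑ i ∈ s, y i‖ ^ 2 = ‖inner 𝕜 (∑ i ∈ s, y i) (∑ i ∈ s, y i)‖ := by
        rw [inner_self_eq_norm_sq_to_K]; simp
    _ = ‖∑ i ∈ s, ∑ j ∈ s, inner 𝕜 (y j) (y i)‖ := by
        rw [inner_sum]; simp only [sum_inner]
    _ ≤ ∑ i ∈ s, ∑ j ∈ s, ((if i = j then M ^ 2 else 0) + ε) := by
        refine (norm_sum_le _ _).trans (Finset.sum_le_sum fun i hi => ?_)
        refine (norm_sum_le _ _).trans (Finset.sum_le_sum fun j hj => ?_)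
        split_ifs with hij
        · subst hij
          rw [inner_self_eq_norm_sq_to_K, hM i hi]
          simpa using hε
        · simpa using h j hj i hi (Ne.symm hij)
    _ = s.card * M ^ 2 + s.card ^ 2 * ε := by
        simp only [Finset.sum_add_distrib, Finset.sum_ite_eq, Finset.sum_const, nsmul_eq_mul]
        rw [Finset.sum_ite_mem, Finset.inter_self, Finset.sum_const, nsmul_eq_mul]
        ring

theorem infinite_image_sq {R : Type*} [CommRing R] [IsDomain R] {D : Set R⁰} (hD : D.Infinite) :
    ((fun b : R⁰ => (b : R) ^ 2) '' D).Infinite := fun hfin => by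
  refine hD ((hfin.preimage' fun r _ => ?_).subset (Set.subset_preimage_image _ _))
  rcases ((fun b : R⁰ => (b : R) ^ 2) ⁻¹' {r}).eq_empty_or_nonempty with h | ⟨b, rfl⟩
  · simp [h]
  · refine ((Set.toFinite ({(b : R), -(b : R)} : Set R)).preimage
      Subtype.val_injective.injOn).subset ?_
    intro x hx
    exact sq_eq_sq_iff_eq_or_eq_neg.1 hx

theorem infinite_of_mem_of_ne_pure {X : Type*} {p : Ultrafilter X} (hp : ∀ x, p ≠ pure x)
    {s : Set X} (hs : s ∈ p) : s.Infinite := fun hfin => by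
  obtain ⟨x, -, hx⟩ := Ultrafilter.eq_pure_of_finite_mem hfin hs
  exact hp x hx

/-! ### Isometric anti-representations of the affine semigroup -/

namespace IsAntiRepresentation

variable {R 𝕜 H : Type*} [CommRing R] [IsDomain R] [RCLike 𝕜]
  [NormedAddCommGroup H] [InnerProductSpace 𝕜 H] {U : affineSemigroup R → H →ₗᵢ[𝕜] H}

theorem add (hU : IsAntiRepresentation U) (u v : R) (φ : H) :
    U (affineAdd (u + v)) φ = U (affineAdd u) (U (affineAdd v) φ) := by
  rw [hU]
  congr 2
  refine Subtype.ext (funext fun x => ?_)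
  change x + (u + v) = x + u + v
  ring

theorem mul (hU : IsAntiRepresentation U) (u v : R⁰) (φ : H) :
    U (affineMul (u * v)) φ = U (affineMul u) (U (affineMul v) φ) := by
  rw [hU]
  congr 2
  refine Subtype.ext (funext fun x => ?_)
  change (u : R) * (v : R) * x = v * (u * x)
  ring

theorem add_mul (hU : IsAntiRepresentation U) (u : R) (w : R⁰) (φ : H) :
    U (affineAdd u) (U (affineMul w) φ) = U (affineMul w) (U (affineAdd (w * u)) φ) := by
  rw [hU, hU]
  congr 2
  refine Subtype.ext (funext fun x => ?_)
  change (w : R) * (x + u) = w * x + w * u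
  ring

theorem add_neg (hU : IsAntiRepresentation U) (v : R) (φ : H) :
    U (affineAdd v) (U (affineAdd (-v)) φ) = φ := by
  refine (U (affineAdd (0 : R))).injective ?_
  rw [← hU.add, ← hU.add]
  simp

theorem inner_add_left (hU : IsAntiRepresentation U) (v : R) (x y : H) :
    inner 𝕜 (U (affineAdd v) x) y = inner 𝕜 x (U (affineAdd (-v)) y) := by
  conv_lhs => rw [← hU.add_neg v y]
  exact (U (affineAdd v)).inner_map_map _ _

/-- For `c ≠ 0` the ideal `cR` has finite index, so precompactness of the orbit under the
translations by elements of `cR` gives precompactness of the full additive orbit. -/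
theorem compactVectors_mul_le (hU : IsAntiRepresentation U) (hR : IsLargeIdealDomain R) {c : R}
    (hc : c ≠ 0) : compactVectors (fun t : R => U (affineAdd (c * t))) ≤
      compactVectors (fun v : R => U (affineAdd v)) := by
  intro χ hχ
  have hχ' : IsCompact (closure (Set.range fun t : R => U (affineAdd (c * t)) χ)) := hχ
  have := hR.finiteIndex c hc
  have hfin : Finite (R ⧸ Submodule.toAddSubgroup (Ideal.span {c})) :=
    AddSubgroup.finite_quotient_of_finiteIndex
  refine (isCompact_iUnion fun r : R ⧸ Submodule.toAddSubgroup (Ideal.span {c}) =>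
    hχ'.image (U (affineAdd r.out)).continuous).closure_of_subset ?_
  rintro _ ⟨v, rfl⟩
  have hmem := QuotientAddGroup.eq.1 (QuotientAddGroup.out_eq'
    (v : R ⧸ Submodule.toAddSubgroup (Ideal.span {c})))
  obtain ⟨t, ht⟩ := Ideal.mem_span_singleton'.1 hmem
  refine Set.mem_iUnion.2 ⟨(v : R ⧸ Submodule.toAddSubgroup (Ideal.span {c})),
    U (affineAdd (c * t)) χ, subset_closure ⟨t, rfl⟩, ?_⟩
  rw [← hU.add, mul_comm c t, ht]
  simp

theorem tendsto_affineAdd (hU : IsAntiRepresentation U)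
    {p : Ultrafilter R} (hp : p ∈ closure (AMI R)) {φ : H}
    (hφ : φ ∈ compactVectors (fun v : R => U (affineAdd v))) :
    Tendsto (fun u => U (affineAdd u) φ) p (𝓝 φ) := by
  rw [Metric.tendsto_nhds]
  intro ε hε
  refine mem_of_mem_closure_ultrafilter hp fun p hp => ?_
  have h : Tendsto (fun g : Multiplicative R => U (affineAdd g.toAdd) φ)
      (p.map Multiplicative.ofAdd) (𝓝 φ) :=
    tendsto_of_mem_compactVectors (T := fun g : Multiplicative R => U (affineAdd g.toAdd))
      (isSyndeticIdempotent_of_mem_AMI hp) (fun g h x => by rw [toAdd_mul, hU.add]) hφ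
  exact Metric.tendsto_nhds.1 h ε hε

/-- The commutation relation turns the correlation of two twisted translates into the correlation
of a single translate by a multiple of `t`. -/
theorem inner_affineMul_affineAdd (hU : IsAntiRepresentation U) (b b' : R⁰) (t : R) (φ : H) :
    inner 𝕜 (U (affineMul b') (U (affineAdd (b * (b * b' * t))) φ))
        (U (affineMul b) (U (affineAdd (b' * (b * b' * t))) φ)) =
      inner 𝕜 (U (affineAdd (((b : R) ^ 2 - (b' : R) ^ 2) * t)) (U (affineMul b') φ))
        (U (affineMul b) φ) := by
  have h1 : (b : R) * (b * b' * t) = b' * ((b' : R) ^ 2 * t + ((b : R) ^ 2 - (b' : R) ^ 2) * t) := by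
    ring
  have h2 : (b' : R) * (b * b' * t) = b * ((b' : R) ^ 2 * t) := by ring
  rw [h1, h2, ← hU.add_mul, ← hU.add_mul, hU.add, LinearIsometry.inner_map_map]

variable [CompleteSpace H]

/-- Multiplications preserve orthogonality to the compact vectors of the translations: the adjoint
of `U (affineMul b)` intertwines the translation by `u` with the translation by `b * u`, so it maps
compact vectors to vectors with precompact orbit under `bR`. -/
theorem affineMul_mem_orthogonal (hU : IsAntiRepresentation U) (hR : IsLargeIdealDomain R)
    (b : R⁰) {φ : H} (hφ : φ ∈ (compactVectors (fun v : R => U (affineAdd v)))ᗮ) :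
    U (affineMul b) φ ∈ (compactVectors (fun v : R => U (affineAdd v)))ᗮ := by
  rw [Submodule.mem_orthogonal]
  intro χ hχ
  have hχ' : IsCompact (closure (Set.range fun v : R => U (affineAdd v) χ)) := hχ
  set m := (U (affineMul b)).toContinuousLinearMap with hm
  have hadj : ∀ x y, inner 𝕜 (m.adjoint x) y = inner 𝕜 x (U (affineMul b) y) := fun x y => by
    rw [ContinuousLinearMap.adjoint_inner_left]; rfl
  have hint : ∀ u, U (affineAdd (b * u)) (m.adjoint χ) = m.adjoint (U (affineAdd u) χ) := by
    intro u
    refine ext_inner_right 𝕜 fun x => ?_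
    rw [hU.inner_add_left, hadj, hadj, hU.inner_add_left, hU.add_mul, mul_neg]
  have hcomp : m.adjoint χ ∈ compactVectors (fun v : R => U (affineAdd v)) := by
    refine hU.compactVectors_mul_le hR (nonZeroDivisors.coe_ne_zero b) ?_
    refine (hχ'.image m.adjoint.continuous).closure_of_subset ?_
    rintro _ ⟨u, rfl⟩
    exact ⟨_, subset_closure ⟨u, rfl⟩, (hint u).symm⟩
  rw [← hadj]
  exact (Submodule.mem_orthogonal _ _).1 hφ _ hcomp

/-- Weak convergence to `0` of the translations by `(c / d) * u`, along `u` divisible by `d`. -/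
theorem eventually_norm_inner_lt (hU : IsAntiRepresentation U) (hR : IsLargeIdealDomain R)
    {p : Ultrafilter R} (hp : p ∈ closure (AMI R)) {φ : H}
    (hφ : φ ∈ (compactVectors (fun v : R => U (affineAdd v)))ᗮ) (χ : H) {c d : R} (hc : c ≠ 0)
    (hd : d ≠ 0) {ε : ℝ} (hε : 0 < ε) :
    ∀ᶠ u in (p : Filter R), ∃ t, u = d * t ∧ ‖inner 𝕜 (U (affineAdd (c * t)) φ) χ‖ < ε := by
  refine mem_of_mem_closure_ultrafilter hp fun p hp => ?_
  have hp' := isSyndeticIdempotent_of_mem_AMI hp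
  obtain ⟨q, rfl, hq⟩ := exists_isSyndeticIdempotent_map_mul hp' hd (hR.range_mul_mem hp' hd)
  have h : Tendsto (fun g : Multiplicative R => inner 𝕜 (U (affineAdd (c * g.toAdd)) φ) χ)
      (q.map Multiplicative.ofAdd) (𝓝 0) :=
    tendsto_inner_zero_of_mem_orthogonal
      (T := fun g : Multiplicative R => U (affineAdd (c * g.toAdd))) hq
      (fun g h x => by rw [toAdd_mul, mul_add, hU.add])
      (Submodule.orthogonal_le (hU.compactVectors_mul_le hR hc) hφ) χ
  have h' : ∀ᶠ t in (q : Filter R), ‖inner 𝕜 (U (affineAdd (c * t)) φ) χ‖ < ε := by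
    have h1 := Metric.tendsto_nhds.1 h ε hε
    simp only [dist_zero_right] at h1
    exact h1
  have : (d * ·) ⁻¹' {u | ∃ t, u = d * t ∧ ‖inner 𝕜 (U (affineAdd (c * t)) φ) χ‖ < ε} ∈ q :=
    mem_of_superset h' fun t ht => ⟨t, rfl, ht⟩
  exact this

/-- If `φ` is orthogonal to the compact vectors of the translations, then
`⟪U (affineAdd u) φ, U (affineMul u) ψ⟫` tends to `0`, by a van der Corput argument: along the
multiplicative idempotent `p` the limit is also approached at `b * u` for infinitely many `b`, and
after multiplication by a common multiple the resulting translates of `φ` are almost orthogonal. -/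
theorem tendsto_inner_zero (hU : IsAntiRepresentation U) (hR : IsLargeIdealDomain R)
    {p : Ultrafilter R⁰} (hp : p ∈ doubleMinimal R) {φ : H}
    (hφ : φ ∈ (compactVectors (fun v : R => U (affineAdd v)))ᗮ) (ψ : H) :
    Tendsto (fun u : R⁰ => inner 𝕜 (U (affineAdd (u : R)) φ) (U (affineMul u) ψ)) p (𝓝 0) := by
  classical
  set f : R⁰ → 𝕜 := fun u => inner 𝕜 (U (affineAdd (u : R)) φ) (U (affineMul u) ψ) with hf
  obtain ⟨L, -, hL⟩ : ∃ L ∈ Metric.closedBall (0 : 𝕜) (‖φ‖ * ‖ψ‖), Tendsto f p (𝓝 L) :=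
    (isCompact_closedBall (0 : 𝕜) (‖φ‖ * ‖ψ‖)).ultrafilter_le_nhds (p.map f)
      (le_principal_iff.2 (Filter.mem_map.2 (Filter.Eventually.of_forall fun u => by
        simpa [hf] using norm_inner_le_norm (𝕜 := 𝕜) (U (affineAdd (u : R)) φ)
          (U (affineMul u) ψ))))
  suffices hL0 : L = 0 by rwa [hL0] at hL
  by_contra hL0
  have hLpos : 0 < ‖L‖ := norm_pos_iff.2 hL0
  obtain ⟨N, hN⟩ := exists_nat_gt (4 * ((‖φ‖ ^ 2 + 1) * ‖ψ‖ ^ 2) / ‖L‖ ^ 2)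
  have hNpos : (0 : ℝ) < N := lt_of_le_of_lt (by positivity) hN
  have hE : ∀ᶠ u in (p : Filter R⁰), dist (f u) L < ‖L‖ / 2 :=
    Metric.tendsto_nhds.1 hL _ (half_pos hLpos)
  -- elements of the set `D` of good dilations with distinct squares, indexed by these squares
  have hD := (isSyndeticIdempotent_of_mem_MMI hp.1).idem _ hE
  obtain ⟨s, hs, hcard⟩ := (infinite_image_sq
    (infinite_of_mem_of_ne_pure hp.1.1 hD)).exists_subset_card_eq N
  have hb : ∀ r, ∃ b : R⁰, r ∈ s → ((b : R) ^ 2 = r ∧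
      ∀ᶠ u in (p : Filter R⁰), dist (f (b * u)) L < ‖L‖ / 2) := fun r => by
    by_cases hr : r ∈ s
    · obtain ⟨b, hb, hbr⟩ := hs hr
      exact ⟨b, fun _ => ⟨hbr, hb⟩⟩
    · exact ⟨1, fun h => (hr h).elim⟩
  choose b hb using hb
  have h1 : ∀ᶠ u in (p : Filter R⁰), ∀ i ∈ s, dist (f (b i * u)) L < ‖L‖ / 2 :=
    (Finset.eventually_all s).2 fun i hi => (hb i hi).2
  have h2 : ∀ᶠ u : R⁰ in (p : Filter R⁰), ∀ i ∈ s, ∀ j ∈ s, i ≠ j →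
      ‖inner 𝕜 (U (affineMul (b j)) (U (affineAdd (b i * u : R)) φ))
        (U (affineMul (b i)) (U (affineAdd (b j * u : R)) φ))‖ ≤ 1 / N := by
    refine (Finset.eventually_all s).2 fun i hi => (Finset.eventually_all s).2 fun j hj => ?_
    by_cases hij : i = j
    · exact Filter.Eventually.of_forall fun u h => (h hij).elim
    have hc : (b i : R) ^ 2 - (b j : R) ^ 2 ≠ 0 := by
      rw [(hb i hi).1, (hb j hj).1]
      exact sub_ne_zero.2 hij
    have hd : (b i : R) * b j ≠ 0 :=
      mul_ne_zero (nonZeroDivisors.coe_ne_zero _) (nonZeroDivisors.coe_ne_zero _)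
    have h : ∀ᶠ u : R⁰ in (p : Filter R⁰), ∃ t, (u : R) = b i * b j * t ∧ _ :=
      hU.eventually_norm_inner_lt hR hp.2 (hU.affineMul_mem_orthogonal hR (b j) hφ)
        (U (affineMul (b i)) φ) hc hd (one_div_pos.2 hNpos)
    filter_upwards [h] with u hu _
    obtain ⟨t, ht, hlt⟩ := hu
    rw [ht, hU.inner_affineMul_affineAdd]
    exact hlt.le
  obtain ⟨u, hu1, hu2⟩ := (h1.and h2).exists
  set B := ∏ i ∈ s, b i with hB
  set w : R → R⁰ := fun i => ∏ k ∈ s.erase i, b k with hw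
  have hwB : ∀ i ∈ s, w i * b i = B := fun i hi => Finset.prod_erase_mul s b hi
  set y : R → H := fun i => U (affineMul (w i)) (U (affineAdd (b i * u : R)) φ) with hy
  have hyχ : ∀ i ∈ s, inner 𝕜 (y i) (U (affineMul (B * u)) ψ) = f (b i * u) := fun i hi => by
    rw [← hwB i hi, mul_assoc, hU.mul, hy, LinearIsometry.inner_map_map]
    rfl
  have hyy : ∀ i ∈ s, ∀ j ∈ s, i ≠ j → ‖inner 𝕜 (y i) (y j)‖ ≤ 1 / N := fun i hi j hj hij => by
    refine le_trans (le_of_eq ?_) (hu2 i hi j hj hij)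
    -- multiplied by `b i * b j`, both vectors become images under the isometry given by `B`
    have e1 : b i * b j * w i = B * b j := by rw [← hwB i hi]; ac_rfl
    have e2 : b i * b j * w j = B * b i := by rw [← hwB j hj]; ac_rfl
    rw [← (U (affineMul (b i * b j))).inner_map_map (y i) (y j), hy]
    simp only
    rw [← hU.mul, ← hU.mul, e1, e2, hU.mul, hU.mul B, LinearIsometry.inner_map_map]
  have hsq := norm_sum_sq_le_of_almost_orthogonal (𝕜 := 𝕜) s y (M := ‖φ‖)
    (fun i _ => by simp [hy]) (by positivity) hyy
  rw [hcard] at hsq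
  have hupper : ‖∑ i ∈ s, f (b i * u)‖ ≤ ‖∑ i ∈ s, y i‖ * ‖ψ‖ := by
    rw [← Finset.sum_congr rfl hyχ, ← sum_inner]
    simpa using norm_inner_le_norm (𝕜 := 𝕜) (∑ i ∈ s, y i) (U (affineMul (B * u)) ψ)
  have hdiff : ‖∑ i ∈ s, f (b i * u) - N * L‖ ≤ N * (‖L‖ / 2) := by
    have h3 : ∑ i ∈ s, f (b i * u) - N * L = ∑ i ∈ s, (f (b i * u) - L) := by
      rw [Finset.sum_sub_distrib, Finset.sum_const, hcard, nsmul_eq_mul]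
    rw [h3]
    refine (norm_sum_le_of_le s fun i hi => ?_).trans_eq
      (by rw [Finset.sum_const, hcard, nsmul_eq_mul])
    rw [← dist_eq_norm]
    exact (hu1 i hi).le
  have hlower : N * (‖L‖ / 2) ≤ ‖∑ i ∈ s, y i‖ * ‖ψ‖ := by
    have h4 : ‖(N : 𝕜) * L‖ = N * ‖L‖ := by simp
    have h5 := norm_sub_norm_le ((N : 𝕜) * L) (∑ i ∈ s, f (b i * u))
    rw [norm_sub_rev, h4] at h5
    linarith
  have hlow2 := pow_le_pow_left₀ (by positivity) hlower 2
  rw [mul_pow, mul_pow] at hlow2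
  have h6 : (N : ℝ) ^ 2 * (‖L‖ / 2) ^ 2 ≤ N * ((‖φ‖ ^ 2 + 1) * ‖ψ‖ ^ 2) := by
    refine hlow2.trans ((mul_le_mul_of_nonneg_right hsq (by positivity)).trans_eq ?_)
    field_simp
  have h7 : N * (‖L‖ / 2) ^ 2 ≤ (‖φ‖ ^ 2 + 1) * ‖ψ‖ ^ 2 := by
    refine le_of_mul_le_mul_left ?_ hNpos
    linarith
  rw [div_lt_iff₀ (by positivity)] at hN
  linarith

end IsAntiRepresentation

/-! ### The correlation of a translation and a dilation -/

theorem mainTheorem1 {R : Type*} [CommRing R] [IsDomain R] (hR : IsLargeIdealDomain R)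
    {𝕜 H : Type*} [RCLike 𝕜] [NormedAddCommGroup H] [InnerProductSpace 𝕜 H] [CompleteSpace H]
    (U : affineSemigroup R → H →ₗᵢ[𝕜] H) (hU : IsAntiRepresentation U)
    (φ ψ : H) (p : Ultrafilter R⁰) (hp : p ∈ doubleMinimal R) :
    Tendsto (fun u : R⁰ => inner 𝕜 (U (affineAdd (u : R)) φ) (U (affineMul u) ψ)) (p : Filter R⁰)
      (𝓝 (inner 𝕜 (compactProjection (fun v : R => U (affineAdd v)) φ)
        (compactProjection (fun u : R⁰ => U (affineMul u)) ψ))) := by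
  set φc := compactProjection (fun v : R => U (affineAdd v)) φ with hφc
  set ψc := compactProjection (fun u : R⁰ => U (affineMul u)) ψ with hψc
  have hpM := isSyndeticIdempotent_of_mem_MMI hp.1
  have h1 : Tendsto (fun u : R⁰ => U (affineAdd (u : R)) φc) p (𝓝 φc) :=
    (hU.tendsto_affineAdd hp.2 (Submodule.starProjection_apply_mem _ φ)).comp
      (tendsto_map : Tendsto (fun u : R⁰ => (u : R)) p _)
  have h2 : Tendsto (fun u : R⁰ => U (affineMul u) ψc) p (𝓝 ψc) :=
    tendsto_of_mem_compactVectors hpM hU.mul (Submodule.starProjection_apply_mem _ ψ)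
  have h3 : Tendsto (fun u : R⁰ => inner 𝕜 φc (U (affineMul u) (ψ - ψc))) p (𝓝 0) := by
    have h := (RCLike.continuous_conj.tendsto (0 : 𝕜)).comp
      (tendsto_inner_zero_of_mem_orthogonal (T := fun u : R⁰ => U (affineMul u)) hpM hU.mul
        (Submodule.sub_starProjection_mem_orthogonal ψ) φc)
    rw [map_zero] at h
    exact h.congr fun u => inner_conj_symm _ _
  have h4 : Tendsto (fun u : R⁰ => inner 𝕜 (U (affineAdd (u : R)) φc - φc)
      (U (affineMul u) (ψ - ψc))) p (𝓝 0) := by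
    refine squeeze_zero_norm (a := fun u : R⁰ => ‖U (affineAdd (u : R)) φc - φc‖ * ‖ψ - ψc‖)
      (fun u => ?_) ?_
    · rw [← (U (affineMul u)).norm_map (ψ - ψc)]
      exact norm_inner_le_norm _ _
    · simpa using ((h1.sub_const φc).norm.mul_const ‖ψ - ψc‖)
  have h5 := hU.tendsto_inner_zero hR hp (Submodule.sub_starProjection_mem_orthogonal φ) ψ
  have h6 := (((h1.inner (𝕜 := 𝕜) h2).add h3).add h4).add h5
  simp only [add_zero] at h6
  refine h6.congr fun u => ?_
  change inner 𝕜 (U (affineAdd (u : R)) φc) (U (affineMul u) ψc) +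
    inner 𝕜 φc (U (affineMul u) (ψ - ψc)) +
    inner 𝕜 (U (affineAdd (u : R)) φc - φc) (U (affineMul u) (ψ - ψc)) +
    inner 𝕜 (U (affineAdd (u : R)) (φ - φc)) (U (affineMul u) ψ) = _
  simp only [map_sub, inner_sub_left, inner_sub_right]
  ring
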